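/- Let $(K_t)_{t\in\mathbb{Z}}$ (the narration) be a stochastic process with values in the natural numbers, and let $(Z_k)_{k\in\mathbb{N}}$ (the knowledge) be a sequence of independent random variables with values in a countable alphabet, jointly independent of $(K_t)_{t\in\mathbb{Z}}$, such that $H(Z_k)\in[C_7,C_8]\subset(0,\infty)$ for all $k$. Consider the Santa Fe process $X_t=(K_t,Z_{K_t})$, $t\in\mathbb{Z}$. Notation: $H(X)=\mathbb{E}(-\log P(X))$ is the Shannon entropy, $H(X|Q)=H(X,Q)-H(Q)$ is the conditional entropy, $V(\mathcal{X})=\mathbb{E}\,\mathrm{card}\,\mathcal{X}$ is the expected cardinality of a random set, $X_j^k=(X_j,\dots,X_k)$ and $\mathcal{K}_j^k=\{K_j,\dots,K_k\}$ (with $X_1^0$ and $\mathcal{K}_1^0$ empty), $V(n)=V(\mathcal{K}_1^n)$, $\Delta V(n)=V(n+1)-V(n)$, and $$h=\inf_{s\ge 1}\sup_{k\ge 0}\frac{H(X_{k+1}^{k+s})}{s},\qquad v=\inf_{s\ge 1}\sup_{k\ge 0}\frac{V(\mathcal{K}_{k+1}^{k+s})}{s}.$$ Then for all integers $s\ge 1$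 and $t\ge 0$: (1) If $v=0$ and $h<\infty$, then $$\sup_{k\ge t}\frac{H(X_{k+1}^{k+s}|X_1^t)}{s}-h\ \ge\ C_7\inf_{k\ge t}\frac{V(\mathcal{K}_{k+1}^{k+s}\setminus\mathcal{K}_1^t)}{s}.$$ (2) If $(K_t)_{t\in\mathbb{Z}}$ is stationary and $H(K_t)<\infty$, then $$\sup_{k\ge t}\frac{H(X_{k+1}^{k+s}|X_1^t)}{s}-h\ \ge\ C_7\sup_{k\ge t}\frac{V(\mathcal{K}_{k+1}^{k+s}\setminus\mathcal{K}_1^t)}{s}\ \ge\ C_7\,\Delta V(t+s).$$ -/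

import Mathlib

open MeasureTheory ProbabilityTheory
open scoped ENNReal

noncomputable section

/-- Shannon entropy `H(X) = E(-log P(X))` (natural logarithm) of a random variable with a countable
alphabet, where `P(x) = μ(X = x)`. Since `-log P(X) ≥ 0` almost surely, the expectation is taken
in `[0, ∞]`. -/
def shannonEntropy {Ω S : Type*} [MeasurableSpace Ω] (μ : Measure Ω) (X : Ω → S) : ℝ≥0∞ :=
  ∫⁻ ω, ENNReal.ofReal (-Real.log (μ.real (X ⁻¹' {X ω}))) ∂μ

/-- Conditional entropy `H(X|Q) = H(X,Q) - H(Q)`, for `H(Q) < ∞`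
(note that `H(X,Q) ≥ H(Q)`, so that the subtraction does not truncate). -/
def condShannonEntropy {Ω S T : Type*} [MeasurableSpace Ω] (μ : Measure Ω)
    (X : Ω → S) (Q : Ω → T) : ℝ≥0∞ :=
  shannonEntropy μ (fun ω => (X ω, Q ω)) - shannonEntropy μ Q

/-- The random string `X_a^b = (X_a, X_{a+1}, …, X_b)`, empty if `b < a`. -/
def block {Ω S : Type*} (X : ℤ → Ω → S) (a b : ℤ) (ω : Ω) : Set.Icc a b → S :=
  fun i => X i ω

/-- The random set of types `𝒦_a^b = {K_a, K_{a+1}, …, K_b}`, empty if `b < a`. -/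
def typeSet {Ω S : Type*} (K : ℤ → Ω → S) (a b : ℤ) (ω : Ω) : Set S :=
  (fun i => K i ω) '' Set.Icc a b

/-- The expected cardinality `V(𝒳) = E card 𝒳` of a random set. -/
def expectedCard {Ω S : Type*} [MeasurableSpace Ω] (μ : Measure Ω) (A : Ω → Set S) : ℝ≥0∞ :=
  ∫⁻ ω, ((A ω).encard : ℝ≥0∞) ∂μ

/-- The entropy rate `h = inf_{s ≥ 1} sup_{k ≥ 0} H(X_{k+1}^{k+s}) / s` of a process. -/
def entropyRate {Ω S : Type*} [MeasurableSpace Ω] (μ : Measure Ω) (X : ℤ → Ω → S) : ℝ≥0∞ :=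
  ⨅ (s : ℕ) (_ : 1 ≤ s), ⨆ k : ℕ, shannonEntropy μ (block X (k + 1) (k + s)) / s

/-- The expected cardinality rate `v = inf_{s ≥ 1} sup_{k ≥ 0} V(𝒦_{k+1}^{k+s}) / s`. -/
def typeRate {Ω S : Type*} [MeasurableSpace Ω] (μ : Measure Ω) (K : ℤ → Ω → S) : ℝ≥0∞ :=
  ⨅ (s : ℕ) (_ : 1 ≤ s), ⨆ k : ℕ, expectedCard μ (typeSet K (k + 1) (k + s)) / s

/-- The Santa Fe process `X_t = (K_t, Z_{K_t})` with narration `K` and knowledge `Z`. -/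
def santaFe {Ω α : Type*} (K : ℤ → Ω → ℕ) (Z : ℕ → Ω → α) (t : ℤ) (ω : Ω) : ℕ × α :=
  (K t ω, Z (K t ω) ω)

/-- Stationarity: the joint law of the two-sided process is invariant under all time shifts. -/
def IsStationaryProcess {Ω S : Type*} [MeasurableSpace Ω] [MeasurableSpace S] (μ : Measure Ω)
    (K : ℤ → Ω → S) : Prop :=
  ∀ n : ℤ, μ.map (fun ω (i : ℤ) => K (i + n) ω) = μ.map (fun ω (i : ℤ) => K i ω)

/-- `sup_{k ≥ t} H(X_{k+1}^{k+s} | X_1^t) / s`. -/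
def supCondEntropyRate {Ω S : Type*} [MeasurableSpace Ω] (μ : Measure Ω) (X : ℤ → Ω → S)
    (s t : ℕ) : ℝ≥0∞ :=
  ⨆ (k : ℕ) (_ : t ≤ k), condShannonEntropy μ (block X (k + 1) (k + s)) (block X 1 t) / s

/-- `V(𝒦_{k+1}^{k+s} ∖ 𝒦_1^t) / s`. -/
def newTypeRate {Ω S : Type*} [MeasurableSpace Ω] (μ : Measure Ω) (K : ℤ → Ω → S)
    (k s t : ℕ) : ℝ≥0∞ :=
  expectedCard μ (fun ω => typeSet K (k + 1) (k + s) ω \ typeSet K 1 t ω) / s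

/-- The finite difference `ΔV(n) = V(n+1) - V(n)` of `V(n) = V(𝒦_1^n)`. Here `V(n) ≤ n` is
finite, and the subtraction is that of the extended real line, without truncation. -/
def deltaTypes {Ω S : Type*} [MeasurableSpace Ω] (μ : Measure Ω) (K : ℤ → Ω → S)
    (n : ℕ) : EReal :=
  (expectedCard μ (typeSet K 1 (n + 1)) : EReal) - (expectedCard μ (typeSet K 1 n) : EReal)

end

/-! Once the narration string is fixed, the Santa Fe string reveals exactly the independent
variables `Z j` for the types `j` that occur. Hence the entropy of a Santa Fe string is the entropy
of its narration plus the sum over `j` of P(`j` occurs) H(`Z j`) (`jointEntropy_santaFe`).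
Conditioning on X_1^t splits H(X_{k+1}^{k+s}|X_1^t) into the narration increment δ =
H(K_{k+1}^{k+s}|K_1^t) and a knowledge term, which is at least C₇ times the expected number of new
types (`add_le_condShannonEntropy_santaFe`).

It remains to bound h by δ/s. If v = 0, the knowledge in a long block has entropy at most C₈ times a
sublinear number of types, so h is at most the linear growth rate of the narration entropy
(`entropyRate_santaFe_le`). Strong subadditivity bounds this rate by the supremum of δ/s over k ≥ t
(`jointEntropy_window_le_of_cond`), which leaves the infimum of the new-type term. Under
stationarity each single k already bounds the rate (`jointEntropy_window_le_of_stationary`), so the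
supremum survives; moreover v = 0 is automatic.

The last inequality is concavity of V under stationarity: the k = t term is an average of increments
of V, all at least ΔV(t+s). -/

/-! ### Entropy of discrete random variables -/

theorem shannonEntropy_congr {Ω S T : Type*} [MeasurableSpace Ω] (μ : Measure Ω)
    {X : Ω → S} {Y : Ω → T} (h : ∀ ω ω', X ω = X ω' ↔ Y ω = Y ω') :
    shannonEntropy μ X = shannonEntropy μ Y := by
  have : ∀ ω, X ⁻¹' {X ω} = Y ⁻¹' {Y ω} := fun ω => by ext ω'; exact h ω' ω
  simp only [shannonEntropy, this]

/-- A countable union of null fibers is null. This discards the points where `Real.log 0 = 0` would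
give a wrong value. -/
theorem ae_fiber_pos {Ω S : Type*} [MeasurableSpace Ω] (μ : Measure Ω) [IsFiniteMeasure μ]
    [Countable S] (X : Ω → S) : ∀ᵐ ω ∂μ, 0 < μ.real (X ⁻¹' {X ω}) := by
  have h : μ (⋃ x : {x : S // μ (X ⁻¹' {x}) = 0}, X ⁻¹' {x.1}) = 0 :=
    measure_iUnion_null fun x => x.2
  refine measure_mono_null (fun ω hω => ?_) h
  have h0 : μ.real (X ⁻¹' {X ω}) = 0 := le_antisymm (not_lt.1 hω) measureReal_nonneg
  rw [measureReal_eq_zero_iff] at h0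
  exact Set.mem_iUnion.2 ⟨⟨X ω, h0⟩, rfl⟩

theorem shannonEntropy_mono {Ω S T : Type*} [MeasurableSpace Ω] (μ : Measure Ω)
    [IsFiniteMeasure μ] [Countable S] {X : Ω → S} {Y : Ω → T}
    (h : ∀ ω ω', X ω = X ω' → Y ω = Y ω') :
    shannonEntropy μ Y ≤ shannonEntropy μ X := by
  refine lintegral_mono_ae ?_
  filter_upwards [ae_fiber_pos μ X] with ω hω
  refine ENNReal.ofReal_le_ofReal (neg_le_neg (Real.log_le_log hω ?_))
  exact measureReal_mono fun ω' hω' => h ω' ω hω'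

theorem measurable_fiber_info {Ω S : Type*} [MeasurableSpace Ω] [MeasurableSpace S] [Countable S]
    [MeasurableSingletonClass S] (μ : Measure Ω) {X : Ω → S} (hX : Measurable X) :
    Measurable fun ω => ENNReal.ofReal (-Real.log (μ.real (X ⁻¹' {X ω}))) :=
  (Measurable.of_discrete (f := fun x => ENNReal.ofReal (-Real.log (μ.real (X ⁻¹' {x}))))).comp hX

theorem tsum_measure_inter_fiber {Ω S : Type*} [MeasurableSpace Ω] [MeasurableSpace S] [Countable S]
    [MeasurableSingletonClass S] (μ : Measure Ω) {X : Ω → S} (hX : Measurable X)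
    {A : Set Ω} (hA : MeasurableSet A) : ∑' x, μ (X ⁻¹' {x} ∩ A) = μ A := by
  rw [← measure_iUnion]
  · congr 1
    ext ω
    simp
  · intro x y hxy
    refine Set.disjoint_left.2 fun ω h1 h2 => hxy ?_
    exact h1.1.symm.trans h2.1
  · exact fun x => (hX (measurableSet_singleton x)).inter hA

/-- Strong subadditivity of entropy. -/
theorem shannonEntropy_submodular {Ω S T R : Type*} [MeasurableSpace Ω]
    [MeasurableSpace S] [Countable S] [MeasurableSingletonClass S]
    [MeasurableSpace T] [Countable T] [MeasurableSingletonClass T]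
    [MeasurableSpace R] [Countable R] [MeasurableSingletonClass R]
    (μ : Measure Ω) [IsProbabilityMeasure μ] {X : Ω → S} {Y : Ω → T} {Q : Ω → R}
    (hX : Measurable X) (hY : Measurable Y) (hQ : Measurable Q) :
    shannonEntropy μ (fun ω => (X ω, Y ω, Q ω)) + shannonEntropy μ Q ≤
      shannonEntropy μ (fun ω => (X ω, Q ω)) + shannonEntropy μ (fun ω => (Y ω, Q ω)) := by
  set W : Ω → S × T × R := fun ω => (X ω, Y ω, Q ω) with hWdef
  set XQ : Ω → S × R := fun ω => (X ω, Q ω) with hXQdef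
  set YQ : Ω → T × R := fun ω => (Y ω, Q ω) with hYQdef
  have hW : Measurable W := hX.prodMk (hY.prodMk hQ)
  have hXQ : Measurable XQ := hX.prodMk hQ
  have hYQ : Measurable YQ := hY.prodMk hQ
  -- P(x,q) P(y,q) / (P(x,y,q) P(q)), whose expectation is at most 1. The claim is then log r ≤ r -
  -- 1 integrated, with all terms moved so that no subtraction occurs in `ℝ≥0∞`.
  set ratio : S × T × R → ℝ≥0∞ := fun w =>
    μ (XQ ⁻¹' {(w.1, w.2.2)}) * μ (YQ ⁻¹' {(w.2.1, w.2.2)}) *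
      (μ (W ⁻¹' {w}) * μ (Q ⁻¹' {w.2.2}))⁻¹ with hratio
  have hpt : ∀ᵐ ω ∂μ,
      ENNReal.ofReal (-Real.log (μ.real (W ⁻¹' {W ω}))) +
        ENNReal.ofReal (-Real.log (μ.real (Q ⁻¹' {Q ω}))) + 1 ≤
      ENNReal.ofReal (-Real.log (μ.real (XQ ⁻¹' {XQ ω}))) +
        ENNReal.ofReal (-Real.log (μ.real (YQ ⁻¹' {YQ ω}))) + ratio (W ω) := by
    filter_upwards [ae_fiber_pos μ W, ae_fiber_pos μ Q, ae_fiber_pos μ XQ,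
      ae_fiber_pos μ YQ] with ω ha hb hc hd
    have hr : ratio (W ω) = ENNReal.ofReal (μ.real (XQ ⁻¹' {XQ ω}) * μ.real (YQ ⁻¹' {YQ ω}) *
        (μ.real (W ⁻¹' {W ω}) * μ.real (Q ⁻¹' {Q ω}))⁻¹) := by
      rw [ENNReal.ofReal_mul (by positivity), ENNReal.ofReal_mul (by positivity),
        ENNReal.ofReal_inv_of_pos (by positivity), ENNReal.ofReal_mul (by positivity)]
      rw [ofReal_measureReal, ofReal_measureReal, ofReal_measureReal, ofReal_measureReal]
    have hlog : ∀ A : Set Ω, 0 ≤ -Real.log (μ.real A) := fun A =>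
      neg_nonneg.2 (Real.log_nonpos measureReal_nonneg measureReal_le_one)
    rw [hr, ← ENNReal.ofReal_one, ← ENNReal.ofReal_add (hlog _) (hlog _),
      ← ENNReal.ofReal_add (hlog _) (hlog _),
      ← ENNReal.ofReal_add (add_nonneg (hlog _) (hlog _)) zero_le_one,
      ← ENNReal.ofReal_add (add_nonneg (hlog _) (hlog _)) (by positivity)]
    refine ENNReal.ofReal_le_ofReal ?_
    generalize μ.real (W ⁻¹' {W ω}) = a at *
    generalize μ.real (Q ⁻¹' {Q ω}) = b at *
    generalize μ.real (XQ ⁻¹' {XQ ω}) = c at *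
    generalize μ.real (YQ ⁻¹' {YQ ω}) = d at *
    have h := Real.log_le_sub_one_of_pos (x := c * d * (a * b)⁻¹) (by positivity)
    rw [Real.log_mul (by positivity) (by positivity), Real.log_inv,
      Real.log_mul (by positivity) (by positivity),
      Real.log_mul (by positivity) (by positivity)] at h
    linarith
  have hE : ∫⁻ ω, ratio (W ω) ∂μ ≤ 1 := by
    rw [← lintegral_map (Measurable.of_discrete (f := ratio)) hW, lintegral_countable']
    calc ∑' w, ratio w * (μ.map W) {w}
        ≤ ∑' w : S × T × R, μ (XQ ⁻¹' {(w.1, w.2.2)}) * μ (YQ ⁻¹' {(w.2.1, w.2.2)}) *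
          (μ (Q ⁻¹' {w.2.2}))⁻¹ := by
          refine ENNReal.tsum_le_tsum fun w => ?_
          rw [Measure.map_apply hW (measurableSet_singleton _), hratio]
          simp only
          rw [ENNReal.mul_inv (Or.inr (measure_ne_top _ _)) (Or.inl (measure_ne_top _ _)),
            mul_assoc]
          refine mul_le_mul_right ?_ _
          rw [mul_right_comm]
          -- The weight of `w` cancels its inverse only up to ≤, because 0 * ∞ = 0 on null atoms.
          refine mul_le_of_le_one_left' ?_
          rw [mul_comm]
          exact ENNReal.mul_inv_le_one _
      _ = ∑' r, ∑' y, ∑' x, μ (X ⁻¹' {x} ∩ Q ⁻¹' {r}) * μ (Y ⁻¹' {y} ∩ Q ⁻¹' {r}) *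
          (μ (Q ⁻¹' {r}))⁻¹ := by
          rw [ENNReal.tsum_prod', ENNReal.tsum_comm, ENNReal.tsum_prod', ENNReal.tsum_comm]
          simp only [hXQdef, hYQdef, ← Set.singleton_prod_singleton, Set.mk_preimage_prod]
      _ = ∑' r, μ (Q ⁻¹' {r}) * μ (Q ⁻¹' {r}) * (μ (Q ⁻¹' {r}))⁻¹ := by
          refine tsum_congr fun r => ?_
          have hr := hQ (measurableSet_singleton r)
          simp only [ENNReal.tsum_mul_right, ENNReal.tsum_mul_left,
            tsum_measure_inter_fiber μ hX hr, tsum_measure_inter_fiber μ hY hr]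
      _ ≤ ∑' r, μ (Q ⁻¹' {r} ∩ Set.univ) := by
          refine ENNReal.tsum_le_tsum fun r => ?_
          rw [Set.inter_univ, mul_assoc]
          exact mul_le_of_le_one_right' (ENNReal.mul_inv_le_one _)
      _ = 1 := by rw [tsum_measure_inter_fiber μ hQ MeasurableSet.univ, measure_univ]
  have h := lintegral_mono_ae hpt
  have mW := measurable_fiber_info μ hW
  have mQ := measurable_fiber_info μ hQ
  have mXQ := measurable_fiber_info μ hXQ
  have mYQ := measurable_fiber_info μ hYQ
  rw [lintegral_add_right _ measurable_const, lintegral_add_left mW, lintegral_const, measure_univ,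
    mul_one, lintegral_add_right _ (show Measurable fun ω => ratio (W ω) from
      (Measurable.of_discrete (f := ratio)).comp hW),
    lintegral_add_left mXQ] at h
  exact (ENNReal.add_le_add_iff_right ENNReal.one_ne_top).1 (h.trans (add_le_add_right hE _))

theorem shannonEntropy_map {Ω E S : Type*} [MeasurableSpace Ω] [MeasurableSpace E]
    [MeasurableSpace S] [Countable S] [MeasurableSingletonClass S] (μ : Measure Ω)
    {U : Ω → E} (hU : Measurable U) {G : E → S} (hG : Measurable G) :
    shannonEntropy (μ.map U) G = shannonEntropy μ (G ∘ U) := by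
  rw [shannonEntropy, lintegral_map (measurable_fiber_info _ hG) hU]
  refine lintegral_congr fun ω => ?_
  rw [map_measureReal_apply hU (hG (measurableSet_singleton _))]
  rfl

theorem shannonEntropy_of_subsingleton {Ω S : Type*} [MeasurableSpace Ω] [Subsingleton S]
    (μ : Measure Ω) [IsProbabilityMeasure μ] (X : Ω → S) : shannonEntropy μ X = 0 := by
  have : ∀ ω, X ⁻¹' {X ω} = Set.univ := fun ω => Set.eq_univ_of_forall fun _ => Subsingleton.elim _ _
  simp [shannonEntropy, this]

/-! ### Expected cardinality as a sum of probabilities -/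

/-- The cardinality of a set of natural numbers, as a sum of indicators. -/
theorem encard_eq_tsum (A : Set ℕ) : (A.encard : ℝ≥0∞) = ∑' j, A.indicator 1 j := by
  rw [← ENNReal.tsum_set_one, tsum_subtype A (fun _ => (1 : ℝ≥0∞))]
  rfl

theorem measurable_encard_of_mem {Ω : Type*} [MeasurableSpace Ω] {A : Ω → Set ℕ}
    (hA : ∀ j, MeasurableSet {ω | j ∈ A ω}) : Measurable fun ω => ((A ω).encard : ℝ≥0∞) := by
  simp only [encard_eq_tsum]
  refine Measurable.tsum fun j => ?_
  exact measurable_one.indicator (hA j)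

theorem expectedCard_eq_tsum {Ω : Type*} [MeasurableSpace Ω] (μ : Measure Ω) {A : Ω → Set ℕ}
    (hA : ∀ j, MeasurableSet {ω | j ∈ A ω}) : expectedCard μ A = ∑' j, μ {ω | j ∈ A ω} := by
  simp only [expectedCard, encard_eq_tsum]
  have h : ∀ j ω, (A ω).indicator (1 : ℕ → ℝ≥0∞) j = {ω | j ∈ A ω}.indicator 1 ω := fun _ _ => rfl
  simp only [h]
  rw [lintegral_tsum fun j => (measurable_one.indicator (hA j)).aemeasurable]
  refine tsum_congr fun j => ?_
  rw [← lintegral_indicator_one (hA j)]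

/-! ### Joint entropy as a submodular function of the index set -/

/-- The joint entropy of the variables with indices in `s`. -/
noncomputable def jointEntropy {Ω S : Type*} [MeasurableSpace Ω] (μ : Measure Ω) (X : ℤ → Ω → S)
    (s : Set ℤ) : ℝ≥0∞ :=
  shannonEntropy μ fun ω (i : s) => X i ω

/-- The set of values taken at the indices in `s`. -/
def valueSet {Ω S : Type*} (K : ℤ → Ω → S) (s : Set ℤ) (ω : Ω) : Set S :=
  (fun i => K i ω) '' s

section Joint

variable {Ω S : Type*} [MeasurableSpace Ω] {μ : Measure Ω} {X : ℤ → Ω → S}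

theorem shannonEntropy_joint_pair (s t : Set ℤ) :
    shannonEntropy μ (fun ω => ((fun (i : s) => X i ω), (fun (i : t) => X i ω))) =
      jointEntropy μ X (s ∪ t) := by
  refine shannonEntropy_congr μ fun ω ω' => ?_
  simp only [Prod.mk.injEq, funext_iff, Subtype.forall, Set.mem_union]
  grind

theorem jointEntropy_singleton (i : ℤ) : jointEntropy μ X {i} = shannonEntropy μ (X i) := by
  refine shannonEntropy_congr μ fun ω ω' => ?_
  simp [funext_iff]

theorem jointEntropy_shift [Countable S] [MeasurableSpace S]
    [MeasurableSingletonClass S] (hX : ∀ i, Measurable (X i)) (hst : IsStationaryProcess μ X)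
    (a b n : ℤ) : jointEntropy μ X (Set.Icc (a + n) (b + n)) = jointEntropy μ X (Set.Icc a b) := by
  have hG : Measurable fun (x : ℤ → S) (i : Set.Icc a b) => x i :=
    measurable_pi_lambda _ fun i => measurable_pi_apply _
  have hU : ∀ n : ℤ, Measurable fun ω (i : ℤ) => X (i + n) ω := fun n =>
    measurable_pi_lambda _ fun i => hX _
  have h0 : Measurable fun ω (i : ℤ) => X i ω := measurable_pi_lambda _ fun i => hX _
  have h1 := shannonEntropy_map μ (hU n) hG
  rw [hst n, shannonEntropy_map μ h0 hG] at h1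
  refine Eq.trans ?_ h1.symm
  refine shannonEntropy_congr μ fun ω ω' => ?_
  simp only [funext_iff, Subtype.forall, Function.comp_apply]
  constructor
  · exact fun h i hi => h (i + n) (by simpa using hi)
  · intro h i hi
    simpa using h (i - n) (by rw [Set.mem_Icc] at hi ⊢; omega)

variable [IsProbabilityMeasure μ]

theorem jointEntropy_empty : jointEntropy μ X ∅ = 0 := shannonEntropy_of_subsingleton μ _

variable [Countable S]

theorem jointEntropy_mono {s t : Set ℤ} [Finite t] (h : s ⊆ t) :
    jointEntropy μ X s ≤ jointEntropy μ X t := by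
  refine shannonEntropy_mono μ fun ω ω' hω => ?_
  simp only [funext_iff, Subtype.forall] at hω ⊢
  exact fun i hi => hω i (h hi)

variable [MeasurableSpace S] [MeasurableSingletonClass S]

theorem jointEntropy_submodular (hX : ∀ i, Measurable (X i)) (s t r : Set ℤ)
    [Finite s] [Finite t] [Finite r] :
    jointEntropy μ X (s ∪ t ∪ r) + jointEntropy μ X r ≤
      jointEntropy μ X (s ∪ r) + jointEntropy μ X (t ∪ r) := by
  have hm : ∀ s : Set ℤ, Measurable fun ω (i : s) => X i ω := fun s =>
    measurable_pi_lambda _ fun i => hX i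
  have h := shannonEntropy_submodular μ (hm s) (hm t) (hm r)
  rw [shannonEntropy_joint_pair, shannonEntropy_joint_pair] at h
  refine le_trans (le_of_eq ?_) h
  congr 1
  refine shannonEntropy_congr μ fun ω ω' => ?_
  simp only [Prod.mk.injEq, funext_iff, Subtype.forall, Set.mem_union]
  grind

theorem jointEntropy_union_le (hX : ∀ i, Measurable (X i)) (s t : Set ℤ)
    [Finite s] [Finite t] :
    jointEntropy μ X (s ∪ t) ≤ jointEntropy μ X s + jointEntropy μ X t := by
  simpa [jointEntropy_empty] using jointEntropy_submodular (μ := μ) hX s t ∅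

theorem jointEntropy_lt_top (hX : ∀ i, Measurable (X i)) {s : Set ℤ} [hs : Finite s]
    (h : ∀ i ∈ s, shannonEntropy μ (X i) < ∞) : jointEntropy μ X s < ∞ := by
  have hs' : s.Finite := hs
  induction s, hs' using Set.Finite.induction_on with
  | empty => simp [jointEntropy_empty]
  | @insert a s ha hfin ih =>
    have : Finite s := hfin
    rw [Set.insert_eq]
    refine (jointEntropy_union_le hX {a} s).trans_lt (ENNReal.add_lt_top.2 ⟨?_, ?_⟩)
    · rw [jointEntropy_singleton]
      exact h a (Set.mem_insert _ _)
    · exact ih (fun i hi => h i (Set.mem_insert_of_mem _ hi))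

end Joint

/-! ### Expected number of types as a submodular function of the index set -/

theorem valueSet_union {Ω : Type*} {K : ℤ → Ω → ℕ} (s t : Set ℤ) (ω : Ω) :
    valueSet K (s ∪ t) ω = valueSet K s ω ∪ valueSet K t ω := Set.image_union _ _ _

section Values

variable {Ω : Type*} [MeasurableSpace Ω] {μ : Measure Ω} {K : ℤ → Ω → ℕ}

theorem measurableSet_mem_valueSet (hK : ∀ t, Measurable (K t)) (s : Set ℤ) (j : ℕ) :
    MeasurableSet {ω | j ∈ valueSet K s ω} := by
  have : {ω | j ∈ valueSet K s ω} = ⋃ i ∈ s, K i ⁻¹' {j} := by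
    ext ω
    simp [valueSet]
  rw [this]
  exact MeasurableSet.biUnion s.to_countable fun i _ => hK i (measurableSet_singleton j)

theorem expectedCard_valueSet_union_le (hK : ∀ t, Measurable (K t)) (s t : Set ℤ) :
    expectedCard μ (valueSet K (s ∪ t)) ≤
      expectedCard μ (valueSet K s) + expectedCard μ (valueSet K t) := by
  unfold expectedCard
  rw [← lintegral_add_left (measurable_encard_of_mem (measurableSet_mem_valueSet hK s))]
  refine lintegral_mono fun ω => ?_
  rw [valueSet_union]
  rw [← ENat.toENNReal_add, ENat.toENNReal_le]
  exact Set.encard_union_le _ _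

theorem expectedCard_diff_add (hK : ∀ t, Measurable (K t)) (s t : Set ℤ) :
    expectedCard μ (fun ω => valueSet K s ω \ valueSet K t ω) + expectedCard μ (valueSet K t) =
      expectedCard μ (valueSet K (s ∪ t)) := by
  unfold expectedCard
  rw [← lintegral_add_right _ (measurable_encard_of_mem (measurableSet_mem_valueSet hK t))]
  refine lintegral_congr fun ω => ?_
  rw [valueSet_union, ← Set.encard_sdiff_add_encard]
  norm_cast

theorem expectedCard_submodular (hK : ∀ t, Measurable (K t)) {s t r : Set ℤ}
    (hs : r ⊆ s) (ht : r ⊆ t) :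
    expectedCard μ (valueSet K (s ∪ t)) + expectedCard μ (valueSet K r) ≤
      expectedCard μ (valueSet K s) + expectedCard μ (valueSet K t) := by
  unfold expectedCard
  rw [← lintegral_add_left (measurable_encard_of_mem (measurableSet_mem_valueSet hK s)),
    ← lintegral_add_left (measurable_encard_of_mem (measurableSet_mem_valueSet hK _))]
  refine lintegral_mono fun ω => ?_
  rw [valueSet_union]
  have h1 := Set.encard_union_add_encard_inter (valueSet K s ω) (valueSet K t ω)
  have h2 : (valueSet K r ω).encard ≤ (valueSet K s ω ∩ valueSet K t ω).encard :=
    Set.encard_le_encard (Set.subset_inter (Set.image_mono hs) (Set.image_mono ht))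
  have h3 : (valueSet K s ω ∪ valueSet K t ω).encard + (valueSet K r ω).encard ≤
      (valueSet K s ω).encard + (valueSet K t ω).encard := by
    rw [← h1]
    gcongr
  rw [← ENat.toENNReal_add, ← ENat.toENNReal_add, ENat.toENNReal_le]
  exact h3

theorem expectedCard_valueSet_le [IsProbabilityMeasure μ] (s : Set ℤ) :
    expectedCard μ (valueSet K s) ≤ s.encard := by
  calc expectedCard μ (valueSet K s) ≤ ∫⁻ _, (s.encard : ℝ≥0∞) ∂μ :=
        lintegral_mono fun ω => by
          have := Set.encard_image_le (fun i => K i ω) s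
          dsimp only
          exact_mod_cast this
    _ = s.encard := by simp

theorem expectedCard_map {E : Type*} [MeasurableSpace E] {U : Ω → E} (hU : Measurable U)
    {A : E → Set ℕ} (hA : ∀ j, MeasurableSet {e | j ∈ A e}) :
    expectedCard (μ.map U) A = expectedCard μ fun ω => A (U ω) :=
  lintegral_map (measurable_encard_of_mem hA) hU

theorem expectedCard_shift (hK : ∀ t, Measurable (K t)) (hst : IsStationaryProcess μ K)
    (a b n : ℤ) : expectedCard μ (valueSet K (Set.Icc (a + n) (b + n))) =
      expectedCard μ (valueSet K (Set.Icc a b)) := by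
  have hU : ∀ n : ℤ, Measurable fun ω (i : ℤ) => K (i + n) ω := fun n =>
    measurable_pi_lambda _ fun i => hK _
  have h0 : Measurable fun ω (i : ℤ) => K i ω := measurable_pi_lambda _ fun i => hK _
  have hA := measurableSet_mem_valueSet (K := fun (t : ℤ) (x : ℤ → ℕ) => x t)
    (fun t => measurable_pi_apply t) (Set.Icc a b)
  have h1 := expectedCard_map (μ := μ) (hU n) hA
  rw [hst n, expectedCard_map h0 hA] at h1
  refine Eq.trans ?_ h1.symm
  congr 1
  ext1 ω
  simp only [valueSet]
  rw [← Set.image_add_const_Icc, Set.image_image]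

end Values

/-! ### Entropy of Santa Fe strings: narration plus mentioned knowledge -/

theorem santaFe_fiber {Ω α : Type*} {K : ℤ → Ω → ℕ} {Z : ℕ → Ω → α}
    (s : Set ℤ) (T : Finset ℕ) (ω : Ω) (hT : (T : Set ℕ) = valueSet K s ω) :
    (fun ω' (i : s) => santaFe K Z i ω') ⁻¹' {fun i : s => santaFe K Z i ω} =
      (⋂ j ∈ T, Z j ⁻¹' {Z j ω}) ∩ (fun ω' (i : s) => K i ω') ⁻¹' {fun i : s => K i ω} := by
  ext ω'
  have hT' : ∀ j, j ∈ T ↔ ∃ i ∈ s, K i ω = j := fun j => by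
    rw [← Finset.mem_coe, hT]; rfl
  simp only [Set.mem_preimage, Set.mem_singleton_iff, funext_iff, Subtype.forall, santaFe,
    Prod.mk.injEq, Set.mem_inter_iff, Set.mem_iInter, hT']
  constructor
  · refine fun h => ⟨?_, fun i hi => (h i hi).1⟩
    rintro j ⟨i, hi, rfl⟩
    have := (h i hi).2
    rwa [(h i hi).1] at this
  · rintro ⟨h1, h2⟩ i hi
    refine ⟨h2 i hi, ?_⟩
    rw [h2 i hi]
    exact h1 _ ⟨i, hi, rfl⟩

theorem measureReal_santaFe_fiber {Ω α : Type*} [MeasurableSpace Ω] [MeasurableSpace α]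
    [MeasurableSingletonClass α] {μ : Measure Ω} {K : ℤ → Ω → ℕ} {Z : ℕ → Ω → α}
    (hZindep : iIndepFun Z μ)
    (hZK : IndepFun (fun ω (k : ℕ) => Z k ω) (fun ω (t : ℤ) => K t ω) μ)
    (s : Set ℤ) [Finite s] (T : Finset ℕ) (ω : Ω) (hT : (T : Set ℕ) = valueSet K s ω) :
    μ.real ((fun ω' (i : s) => santaFe K Z i ω') ⁻¹' {fun i : s => santaFe K Z i ω}) =
      (∏ j ∈ T, μ.real (Z j ⁻¹' {Z j ω})) *
        μ.real ((fun ω' (i : s) => K i ω') ⁻¹' {fun i : s => K i ω}) := by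
  rw [santaFe_fiber s T ω hT]
  have hA : MeasurableSet (⋂ j ∈ T, (fun z : ℕ → α => z j) ⁻¹' {Z j ω}) :=
    Finset.measurableSet_biInter _ fun j _ => measurable_pi_apply j (measurableSet_singleton _)
  have hB : MeasurableSet ((fun (x : ℤ → ℕ) (i : s) => x i) ⁻¹' {fun i : s => K i ω}) :=
    (measurable_pi_lambda _ fun i => measurable_pi_apply _ :
      Measurable fun (x : ℤ → ℕ) (i : s) => x i) (measurableSet_singleton _)
  have h := hZK.measure_inter_preimage_eq_mul _ _ hA hB
  have h2 := hZindep.measure_inter_preimage_eq_mul (S := T) (sets := fun j => {Z j ω})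
    fun j _ => measurableSet_singleton _
  rw [Set.preimage_iInter₂] at h
  simp only [← Set.preimage_comp] at h
  simp only [Measure.real]
  rw [← ENNReal.toReal_prod, ← ENNReal.toReal_mul, ← h2]
  exact congrArg ENNReal.toReal h

section SantaFe

variable {Ω α : Type*} [MeasurableSpace Ω] [MeasurableSpace α] [Countable α]
  [MeasurableSingletonClass α] {μ : Measure Ω}
  {K : ℤ → Ω → ℕ} {Z : ℕ → Ω → α}

variable [IsProbabilityMeasure μ]

/-- The entropy of a Santa Fe string splits into the entropy of the narration and the entropies
of the pieces of knowledge that are mentioned. -/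
theorem jointEntropy_santaFe (hK : ∀ t, Measurable (K t)) (hZ : ∀ k, Measurable (Z k))
    (hZindep : iIndepFun Z μ)
    (hZK : IndepFun (fun ω (k : ℕ) => Z k ω) (fun ω (t : ℤ) => K t ω) μ)
    (s : Set ℤ) [hs : Finite s] :
    jointEntropy μ (santaFe K Z) s = jointEntropy μ K s +
      ∑' j, μ {ω | j ∈ valueSet K s ω} * shannonEntropy μ (Z j) := by
  set g : ℕ → α → ℝ≥0∞ := fun j z => ENNReal.ofReal (-Real.log (μ.real (Z j ⁻¹' {z}))) with hg
  have hgm : ∀ j, Measurable (g j) := fun j => Measurable.of_discrete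
  have hmK : Measurable fun ω (i : s) => K i ω := measurable_pi_lambda _ fun i => hK i
  have hlog : ∀ A : Set Ω, 0 ≤ -Real.log (μ.real A) := fun A =>
    neg_nonneg.2 (Real.log_nonpos measureReal_nonneg measureReal_le_one)
  -- The fiber probability factors by independence, so the information is additive pointwise. The
  -- sum over occurring types is written with indicators so that it can be integrated term by term.
  have hpt : ∀ᵐ ω ∂μ, ENNReal.ofReal (-Real.log (μ.real
      ((fun ω' (i : s) => santaFe K Z i ω') ⁻¹' {fun i : s => santaFe K Z i ω}))) =
      ENNReal.ofReal (-Real.log (μ.real ((fun ω' (i : s) => K i ω') ⁻¹' {fun i : s => K i ω}))) +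
        ∑' j, {ω | j ∈ valueSet K s ω}.indicator 1 ω * g j (Z j ω) := by
    have hZpos : ∀ᵐ ω ∂μ, ∀ j, 0 < μ.real (Z j ⁻¹' {Z j ω}) :=
      ae_all_iff.2 fun j => ae_fiber_pos μ (Z j)
    filter_upwards [hZpos, ae_fiber_pos μ fun ω (i : s) => K i ω] with ω h1 h2
    have hfin : (valueSet K s ω).Finite := Set.Finite.image _ hs
    have hT : (hfin.toFinset : Set ℕ) = valueSet K s ω := hfin.coe_toFinset
    rw [measureReal_santaFe_fiber hZindep hZK s _ ω hT,
      Real.log_mul (Finset.prod_pos fun j _ => h1 j).ne' h2.ne',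
      Real.log_prod fun j _ => (h1 j).ne', neg_add_rev, ← Finset.sum_neg_distrib,
      ENNReal.ofReal_add (hlog _) (Finset.sum_nonneg fun j _ => hlog _),
      ENNReal.ofReal_sum_of_nonneg fun j _ => hlog _]
    congr 1
    rw [tsum_eq_sum (s := hfin.toFinset)]
    · refine Finset.sum_congr rfl fun j hj => ?_
      have hj' : ω ∈ {ω | j ∈ valueSet K s ω} := hfin.mem_toFinset.1 hj
      rw [Set.indicator_of_mem hj', Pi.one_apply, one_mul]
    · intro j hj
      have hj' : ω ∉ {ω | j ∈ valueSet K s ω} := fun h => hj (hfin.mem_toFinset.2 h)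
      rw [Set.indicator_of_notMem hj', zero_mul]
  have hind : ∀ j, Measurable ({ω | j ∈ valueSet K s ω}.indicator (1 : Ω → ℝ≥0∞)) := fun j =>
    measurable_one.indicator (measurableSet_mem_valueSet hK s j)
  unfold jointEntropy
  rw [shannonEntropy, lintegral_congr_ae hpt, lintegral_add_left (measurable_fiber_info μ hmK),
    lintegral_tsum fun j => (show Measurable fun ω =>
      {ω | j ∈ valueSet K s ω}.indicator (1 : Ω → ℝ≥0∞) ω * g j (Z j ω) from
        (hind j).mul ((hgm j).comp (hZ j))).aemeasurable]
  congr 1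
  refine tsum_congr fun j => ?_
  -- Occurrence of `j` depends on the narration alone, hence is independent of `Z j`.
  have hI : IndepFun ({ω | j ∈ valueSet K s ω}.indicator (1 : Ω → ℝ≥0∞))
      (fun ω => g j (Z j ω)) μ := by
    have h := hZK.symm.comp
      (φ := {x : ℤ → ℕ | j ∈ valueSet (fun t (x : ℤ → ℕ) => x t) s x}.indicator (1 : (ℤ → ℕ) → ℝ≥0∞))
      (ψ := fun z : ℕ → α => g j (z j))
      (measurable_one.indicator
        (measurableSet_mem_valueSet (fun t => measurable_pi_apply t) s j))
      ((hgm j).comp (measurable_pi_apply j))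
    exact h
  have h := lintegral_mul_eq_lintegral_mul_lintegral_of_indepFun (hind j)
    ((hgm j).comp (hZ j)) hI
  rw [lintegral_indicator_one (measurableSet_mem_valueSet hK s j)] at h
  exact h

theorem jointEntropy_santaFe_le (hK : ∀ t, Measurable (K t)) (hZ : ∀ k, Measurable (Z k))
    (hZindep : iIndepFun Z μ)
    (hZK : IndepFun (fun ω (k : ℕ) => Z k ω) (fun ω (t : ℤ) => K t ω) μ)
    {C : ℝ≥0∞} (hZup : ∀ k, shannonEntropy μ (Z k) ≤ C) (s : Set ℤ) [Finite s] :
    jointEntropy μ (santaFe K Z) s ≤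
      jointEntropy μ K s + C * expectedCard μ (valueSet K s) := by
  rw [jointEntropy_santaFe hK hZ hZindep hZK,
    expectedCard_eq_tsum μ (measurableSet_mem_valueSet hK s), mul_comm, ← ENNReal.tsum_mul_right]
  gcongr with j
  exact hZup j

/-- A type occurring on `s ∪ t` either occurs on `t` or is new on `s`, and each new one costs at
least `C`. The additive form needs no finiteness of the entropies. -/
theorem jointEntropy_santaFe_union_ge (hK : ∀ t, Measurable (K t)) (hZ : ∀ k, Measurable (Z k))
    (hZindep : iIndepFun Z μ)
    (hZK : IndepFun (fun ω (k : ℕ) => Z k ω) (fun ω (t : ℤ) => K t ω) μ)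
    {C : ℝ≥0∞} (hZlow : ∀ k, C ≤ shannonEntropy μ (Z k)) (s t : Set ℤ) [Finite s] [Finite t] :
    jointEntropy μ K (s ∪ t) +
        C * expectedCard μ (fun ω => valueSet K s ω \ valueSet K t ω) +
        jointEntropy μ (santaFe K Z) t ≤
      jointEntropy μ (santaFe K Z) (s ∪ t) + jointEntropy μ K t := by
  have hm := measurableSet_mem_valueSet hK
  have hd : ∀ j, MeasurableSet {ω | j ∈ valueSet K s ω \ valueSet K t ω} := fun j =>
    (hm s j).diff (hm t j)
  have hu : ∀ j, μ {ω | j ∈ valueSet K (s ∪ t) ω} =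
      μ {ω | j ∈ valueSet K s ω \ valueSet K t ω} + μ {ω | j ∈ valueSet K t ω} := fun j => by
    rw [← measure_union _ (hm t j)]
    · congr 1
      ext ω
      simp only [valueSet_union, Set.mem_ofPred_eq, Set.mem_union, Set.mem_sdiff]
      tauto
    · exact Set.disjoint_left.2 fun ω h1 h2 => h1.2 h2
  rw [jointEntropy_santaFe hK hZ hZindep hZK, jointEntropy_santaFe hK hZ hZindep hZK,
    expectedCard_eq_tsum μ hd, mul_comm C, ← ENNReal.tsum_mul_right]
  simp only [hu, add_mul]
  rw [ENNReal.tsum_add]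
  have : ∑' j, μ {ω | j ∈ valueSet K s ω \ valueSet K t ω} * C ≤
      ∑' j, μ {ω | j ∈ valueSet K s ω \ valueSet K t ω} * shannonEntropy μ (Z j) := by
    gcongr with j
    exact hZlow j
  calc _ ≤ jointEntropy μ K (s ∪ t) +
        ∑' j, μ {ω | j ∈ valueSet K s ω \ valueSet K t ω} * shannonEntropy μ (Z j) +
        (jointEntropy μ K t + ∑' j, μ {ω | j ∈ valueSet K t ω} * shannonEntropy μ (Z j)) := by
        gcongr
    _ = _ := by ring

end SantaFe

/-! ### Time windows -/

/-- The time window `{k + 1, …, k + m}`. -/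
def window (k m : ℕ) : Set ℤ := Set.Icc ((k : ℤ) + 1) (k + m)

instance (k m : ℕ) : Finite (window k m) := inferInstanceAs (Finite (Set.Icc _ _))

theorem window_add (k m n : ℕ) : window k (m + n) = window k m ∪ window (k + m) n := by
  ext i
  simp only [window, Set.mem_Icc, Set.mem_union]
  omega

theorem window_zero_left (m : ℕ) : window 0 m = Set.Icc 1 (m : ℤ) := by simp [window]

theorem window_encard (k m : ℕ) : (window k m).encard = m := by
  rw [window, ← Finset.coe_Icc, Set.encard_coe_eq_coe_finsetCard, Int.card_Icc]
  congr 1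
  omega

/-! ### Stationary narrations: vanishing type rate and concavity of V -/

section Stationary

variable {Ω : Type*} [MeasurableSpace Ω] {μ : Measure Ω} {K : ℤ → Ω → ℕ}

theorem jointEntropy_window_shift (hK : ∀ t, Measurable (K t)) (hst : IsStationaryProcess μ K)
    (k m : ℕ) : jointEntropy μ K (window k m) = jointEntropy μ K (window 0 m) := by
  have h := jointEntropy_shift hK hst 1 m k
  rw [window_zero_left, ← h, window, add_comm (k : ℤ), add_comm (k : ℤ)]

theorem expectedCard_window_shift (hK : ∀ t, Measurable (K t)) (hst : IsStationaryProcess μ K)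
    (k m : ℕ) :
    expectedCard μ (valueSet K (window k m)) = expectedCard μ (valueSet K (window 0 m)) := by
  have h := expectedCard_shift hK hst 1 m k
  rw [window_zero_left, ← h, window, add_comm (k : ℤ), add_comm (k : ℤ)]

theorem measure_fiber_of_stationary (hK : ∀ t, Measurable (K t)) (hst : IsStationaryProcess μ K)
    (i : ℤ) (j : ℕ) : μ (K i ⁻¹' {j}) = μ (K 0 ⁻¹' {j}) := by
  have hU : ∀ n : ℤ, Measurable fun ω (i : ℤ) => K (i + n) ω := fun n =>
    measurable_pi_lambda _ fun i => hK _
  have h0 : Measurable fun ω (i : ℤ) => K i ω := measurable_pi_lambda _ fun i => hK _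
  have hA : MeasurableSet ((fun x : ℤ → ℕ => x 0) ⁻¹' {j}) :=
    measurable_pi_apply 0 (measurableSet_singleton j)
  have h := congrArg (fun ν => ν ((fun x : ℤ → ℕ => x 0) ⁻¹' {j})) (hst i)
  simp only [Measure.map_apply (hU i) hA, Measure.map_apply h0 hA] at h
  simpa [Set.preimage] using h

theorem measure_mem_window_le (hK : ∀ t, Measurable (K t)) (hst : IsStationaryProcess μ K)
    (k m j : ℕ) : μ {ω | j ∈ valueSet K (window k m) ω} ≤ m * μ (K 0 ⁻¹' {j}) := by
  have : {ω | j ∈ valueSet K (window k m) ω} =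
      ⋃ i ∈ Finset.Icc ((k : ℤ) + 1) (k + m), K i ⁻¹' {j} := by
    ext ω
    simp [valueSet, window]
  rw [this]
  refine (measure_biUnion_finset_le _ _).trans ?_
  simp only [measure_fiber_of_stationary hK hst, Finset.sum_const, Int.card_Icc, nsmul_eq_mul]
  gcongr
  omega

/-- Types below M number at most M, and those from M on contribute at most m P(K₀ ≥ M) to a window
of length m. Divide by m, let m → ∞, then M → ∞. -/
theorem typeRate_eq_zero_of_stationary [IsProbabilityMeasure μ] (hK : ∀ t, Measurable (K t))
    (hst : IsStationaryProcess μ K) : typeRate μ K = 0 := by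
  set q : ℕ → ℝ≥0∞ := fun j => μ (K 0 ⁻¹' {j}) with hq
  have hqsum : ∑' j, q j ≠ ∞ := by
    have := tsum_measure_inter_fiber μ (hK 0) MeasurableSet.univ
    simp only [Set.inter_univ, measure_univ] at this
    rw [hq, this]
    exact ENNReal.one_ne_top
  have hV : ∀ M k m : ℕ, expectedCard μ (valueSet K (window k m)) ≤
      M + m * ∑' j, q (j + M) := fun M k m => by
    rw [expectedCard_eq_tsum μ (measurableSet_mem_valueSet hK _),
      ← Summable.sum_add_tsum_nat_add' (k := M) ENNReal.summable, ← ENNReal.tsum_mul_left]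
    refine add_le_add ?_ (ENNReal.tsum_le_tsum fun j => measure_mem_window_le hK hst k m _)
    refine (Finset.sum_le_sum fun j _ => prob_le_one).trans ?_
    simp
  have h1 : ∀ M m : ℕ, 1 ≤ m → typeRate μ K ≤ M * (m : ℝ≥0∞)⁻¹ + ∑' j, q (j + M) := by
    intro M m hm
    refine iInf₂_le_of_le m hm (iSup_le fun k => ?_)
    have hm0 : (m : ℝ≥0∞) ≠ 0 := by exact_mod_cast (by omega : m ≠ 0)
    refine ENNReal.div_le_of_le_mul ((hV M k m).trans_eq ?_)
    rw [add_mul, mul_assoc, ENNReal.inv_mul_cancel hm0 (ENNReal.natCast_ne_top m), mul_one,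
      mul_comm (m : ℝ≥0∞)]
  have h2 : ∀ M : ℕ, typeRate μ K ≤ ∑' j, q (j + M) := by
    intro M
    have hlim : Filter.Tendsto (fun m : ℕ => M * (m : ℝ≥0∞)⁻¹ + ∑' j, q (j + M)) Filter.atTop
        (nhds (M * 0 + ∑' j, q (j + M))) :=
      (ENNReal.Tendsto.const_mul ENNReal.tendsto_inv_nat_nhds_zero
        (Or.inr (ENNReal.natCast_ne_top M))).add_const _
    rw [mul_zero, zero_add] at hlim
    exact ge_of_tendsto hlim (Filter.eventually_atTop.2 ⟨1, fun m hm => h1 M m hm⟩)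
  exact le_antisymm (ge_of_tendsto' (ENNReal.tendsto_sum_nat_add q hqsum) h2) bot_le

theorem deltaTypes_le_newTypeRate [IsProbabilityMeasure μ] (hK : ∀ t, Measurable (K t))
    (hst : IsStationaryProcess μ K) (s t : ℕ) (hs : 1 ≤ s) :
    deltaTypes μ K (t + s) ≤ (newTypeRate μ K t s t : EReal) := by
  set V : ℕ → ℝ≥0∞ := fun n => expectedCard μ (valueSet K (window 0 n)) with hV
  have hVfin : ∀ n, V n ≠ ∞ := fun n => by
    refine ((expectedCard_valueSet_le _).trans_lt ?_).ne
    rw [window_encard]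
    exact ENNReal.natCast_lt_top n
  -- Concavity: two windows of length m + 1, offset by one, overlap in a window of length m.
  have hconc : ∀ m, V (m + 2) + V m ≤ V (m + 1) + V (m + 1) := fun m => by
    have h := expectedCard_submodular (μ := μ) hK (s := window 0 (m + 1)) (t := window 1 (m + 1))
      (r := window 1 m) (fun i => by simp only [window, Set.mem_Icc]; omega)
      (fun i => by simp only [window, Set.mem_Icc]; omega)
    have hu : window 0 (m + 1) ∪ window 1 (m + 1) = window 0 (m + 2) := by
      ext i
      simp only [window, Set.mem_Icc, Set.mem_union]
      omega
    rwa [hu, expectedCard_window_shift hK hst 1, expectedCard_window_shift hK hst 1] at h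
  set v : ℕ → ℝ := fun n => (V n).toReal with hv
  have hconc' : ∀ m, v (m + 2) - v (m + 1) ≤ v (m + 1) - v m := fun m => by
    have h := ENNReal.toReal_mono (ENNReal.add_ne_top.2 ⟨hVfin _, hVfin _⟩) (hconc m)
    rw [ENNReal.toReal_add (hVfin _) (hVfin _), ENNReal.toReal_add (hVfin _) (hVfin _)] at h
    simp only [hv]
    linarith
  have hanti : Antitone fun m => v (m + 1) - v m := antitone_nat_of_succ_le hconc'
  -- Telescoping: each of the increments from t on is at least the later increment at t + s.
  have hsum : ∀ j, j ≤ s → j * (v (t + s + 1) - v (t + s)) ≤ v (t + j) - v t := by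
    intro j
    induction j with
    | zero => simp
    | succ j ih =>
      intro hj
      have h1 := ih (by omega)
      have h2 : v (t + s + 1) - v (t + s) ≤ v (t + j + 1) - v (t + j) := hanti (by omega)
      rw [← add_assoc]
      push_cast
      linarith
  have hnew : newTypeRate μ K t s t = ENNReal.ofReal ((v (t + s) - v t) / s) := by
    have h := expectedCard_diff_add (μ := μ) hK (window t s) (window 0 t)
    have hu : window t s ∪ window 0 t = window 0 (t + s) := by
      rw [window_add, zero_add, Set.union_comm]
    rw [hu] at h
    have hsub := ENNReal.eq_sub_of_add_eq (hVfin t) h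
    have hnt : newTypeRate μ K t s t =
        expectedCard μ (fun ω => valueSet K (window t s) ω \ valueSet K (window 0 t) ω) / s := by
      rw [window_zero_left]
      rfl
    rw [hnt, hsub, ENNReal.ofReal_div_of_pos (by exact_mod_cast hs),
      ENNReal.ofReal_sub _ ENNReal.toReal_nonneg, ENNReal.ofReal_toReal (hVfin _),
      ENNReal.ofReal_toReal (hVfin _), ENNReal.ofReal_natCast]
  have hd : deltaTypes μ K (t + s) = ((v (t + s + 1) - v (t + s) : ℝ) : EReal) := by
    have hc : ∀ n, (V n : EReal) = ((v n : ℝ) : EReal) := fun n =>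
      (EReal.coe_ennreal_toReal (hVfin n)).symm
    rw [EReal.coe_sub, ← hc, ← hc]
    simp only [deltaTypes, hV, window_zero_left]
    push_cast
    rfl
  rw [hnew, hd, EReal.coe_ennreal_ofReal]
  refine EReal.coe_le_coe_iff.2 ((?_ : _ ≤ _).trans (le_max_left _ _))
  rw [le_div_iff₀ (by exact_mod_cast hs), mul_comm]
  exact hsum s le_rfl

end Stationary

/-! ### Linear growth bounds for narration entropy and type counts -/

section Growth

variable {Ω : Type*} [MeasurableSpace Ω] {μ : Measure Ω} [IsProbabilityMeasure μ]
  {K : ℤ → Ω → ℕ}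

/-- Given K_1^t, the conditional entropies of consecutive blocks of length s are subadditive, so n
blocks cost at most n `a`. -/
theorem jointEntropy_window_le_of_cond (hK : ∀ t, Measurable (K t)) (s t : ℕ) {a : ℝ≥0∞}
    (hfin : jointEntropy μ K (window 0 t) ≠ ∞)
    (ha : ∀ k, t ≤ k → jointEntropy μ K (window k s ∪ window 0 t) ≤
      a + jointEntropy μ K (window 0 t)) (n k : ℕ) :
    jointEntropy μ K (window k (n * s)) ≤ jointEntropy μ K (window 0 t) + n * a := by
  have key : ∀ n k : ℕ, t ≤ k → jointEntropy μ K (window k (n * s) ∪ window 0 t) ≤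
      jointEntropy μ K (window 0 t) + n * a := by
    intro n k hk
    induction n with
    | zero =>
      have : window k (0 * s) ∪ window 0 t = window 0 t := by
        ext i
        simp only [window, Set.mem_Icc, Set.mem_union]
        omega
      rw [this]
      exact le_self_add
    | succ n ih =>
      have h := jointEntropy_submodular (μ := μ) hK (window k (n * s)) (window (k + n * s) s)
        (window 0 t)
      rw [← window_add, ← Nat.succ_mul] at h
      refine (ENNReal.add_le_add_iff_right hfin).1 (h.trans ?_)
      refine (add_le_add ih (ha _ (by omega))).trans_eq ?_
      push_cast
      ring
  rcases le_total t k with hk | hk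
  · exact (jointEntropy_mono Set.subset_union_left).trans (key n k hk)
  -- A window starting before t lies in the first t positions together with the window of the same
  -- length starting at t.
  · refine (jointEntropy_mono fun i => ?_).trans (key n t le_rfl)
    simp only [window, Set.mem_Icc, Set.mem_union]
    omega

/-- A bound at a single position k suffices: stationarity moves it along, and conditioning on more
than the k preceding symbols only lowers the increment. -/
theorem jointEntropy_window_le_of_stationary (hK : ∀ t, Measurable (K t))
    (hst : IsStationaryProcess μ K) (s k : ℕ) {b : ℝ≥0∞}
    (hfin : jointEntropy μ K (window 0 k) ≠ ∞)
    (hb : jointEntropy μ K (window 0 (k + s)) ≤ b + jointEntropy μ K (window 0 k)) (n j : ℕ) :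
    jointEntropy μ K (window j (n * s)) ≤ jointEntropy μ K (window 0 k) + n * b := by
  have key : jointEntropy μ K (window 0 (k + n * s)) ≤
      jointEntropy μ K (window 0 k) + n * b := by
    induction n with
    | zero => simp
    | succ n ih =>
      -- Here the last s symbols are compared given the k symbols just before them and given the
      -- whole past.
      have h := jointEntropy_submodular (μ := μ) hK (window 0 (n * s)) (window (n * s + k) s)
        (window (n * s) k)
      have h1 : window 0 (n * s) ∪ window (n * s + k) s ∪ window (n * s) k =
          window 0 (k + (n + 1) * s) := by
        ext i
        simp only [window, Set.mem_Icc, Set.mem_union, add_mul]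
        omega
      have h2 : window 0 (n * s) ∪ window (n * s) k = window 0 (k + n * s) := by
        rw [add_comm k, window_add, zero_add]
      have h3 : window (n * s + k) s ∪ window (n * s) k = window (n * s) (k + s) := by
        rw [window_add, Set.union_comm]
      rw [h1, h2, h3, jointEntropy_window_shift hK hst (n * s) (k + s),
        jointEntropy_window_shift hK hst (n * s) k] at h
      refine (ENNReal.add_le_add_iff_right hfin).1 (h.trans ?_)
      refine (add_le_add ih hb).trans_eq ?_
      push_cast
      ring
  rw [jointEntropy_window_shift hK hst]
  refine (jointEntropy_mono fun i => ?_).trans key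
  simp only [window, Set.mem_Icc]
  omega

theorem expectedCard_window_mul_le (hK : ∀ t, Measurable (K t)) (m : ℕ) {w : ℝ≥0∞}
    (hw : ∀ k, expectedCard μ (valueSet K (window k m)) ≤ w) (N k : ℕ) :
    expectedCard μ (valueSet K (window k (N * m))) ≤ N * w := by
  induction N with
  | zero =>
    refine (expectedCard_valueSet_le _).trans ?_
    rw [window_encard]
    simp
  | succ N ih =>
    rw [Nat.succ_mul, window_add]
    refine (expectedCard_valueSet_union_le hK _ _).trans ((add_le_add ih (hw _)).trans_eq ?_)
    push_cast
    ring

end Growth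

/-! ### The rate h against narration increments, and finiteness of the entropies -/

section SantaFe

variable {Ω α : Type*} [MeasurableSpace Ω] [MeasurableSpace α] [Countable α]
  [MeasurableSingletonClass α] {μ : Measure Ω} [IsProbabilityMeasure μ]
  {K : ℤ → Ω → ℕ} {Z : ℕ → Ω → α}

/-- Knowledge costs at most `C` per distinct type, which is negligible per unit time when v = 0. The
constant `H` is a start-up cost that disappears in the limit. -/
theorem entropyRate_santaFe_le (hK : ∀ t, Measurable (K t)) (hZ : ∀ k, Measurable (Z k))
    (hZindep : iIndepFun Z μ)
    (hZK : IndepFun (fun ω (k : ℕ) => Z k ω) (fun ω (t : ℤ) => K t ω) μ)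
    {C : ℝ≥0∞} (hC : C ≠ ∞) (hZup : ∀ k, shannonEntropy μ (Z k) ≤ C)
    (hv : typeRate μ K = 0) {s : ℕ} (hs : 1 ≤ s) {H a : ℝ≥0∞} (hH : H ≠ ∞)
    (h : ∀ n k : ℕ, jointEntropy μ K (window k (n * s)) ≤ H + n * a) :
    entropyRate μ (santaFe K Z) ≤ a / s := by
  have hcast : ∀ n : ℕ, 1 ≤ n → (n : ℝ≥0∞) ≠ 0 := fun n hn => by
    exact_mod_cast (by omega : n ≠ 0)
  have h1 : ∀ m N : ℕ, 1 ≤ m → 1 ≤ N → entropyRate μ (santaFe K Z) ≤ H * (N : ℝ≥0∞)⁻¹ +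
      (a / s + C * ⨆ k : ℕ, expectedCard μ (typeSet K (k + 1) (k + m)) / m) := by
    intro m N hm hN
    set w := ⨆ k : ℕ, expectedCard μ (typeSet K (k + 1) (k + m)) / m with hw
    have hw' : ∀ k, expectedCard μ (valueSet K (window k m)) ≤ m * w := fun k => by
      refine (ENNReal.div_le_iff_le_mul (Or.inl (hcast m hm))
        (Or.inl (ENNReal.natCast_ne_top m))).1 ?_ |>.trans_eq (mul_comm _ _)
      exact le_iSup (fun k : ℕ => expectedCard μ (typeSet K (k + 1) (k + m)) / m) k
    have hns : 1 ≤ N * m * s := Nat.mul_pos (Nat.mul_pos hN hm) hs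
    -- This length splits into N m blocks of length s for the narration bound and into N s blocks of
    -- length m for the type count.
    refine iInf₂_le_of_le (N * m * s) hns (iSup_le fun k => ENNReal.div_le_of_le_mul ?_)
    have e1 := jointEntropy_santaFe_le hK hZ hZindep hZK hZup (window k (N * m * s))
    have e2 := expectedCard_window_mul_le hK m hw' (N * s) k
    rw [show N * s * m = N * m * s by ring] at e2
    refine (e1.trans (add_le_add (h (N * m) k) (mul_le_mul_right e2 C))).trans ?_
    have hN1 : (N : ℝ≥0∞)⁻¹ * N = 1 :=
      ENNReal.inv_mul_cancel (hcast N hN) (ENNReal.natCast_ne_top N)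
    have hs1 : (s : ℝ≥0∞)⁻¹ * s = 1 :=
      ENNReal.inv_mul_cancel (hcast s hs) (ENNReal.natCast_ne_top s)
    have hms : (1 : ℝ≥0∞) ≤ m * s := by exact_mod_cast Nat.mul_pos hm hs
    have hH' : H ≤ H * (m * s) := le_mul_of_one_le_right' hms
    rw [div_eq_mul_inv]
    push_cast
    calc H + N * m * a + C * (N * s * (m * w))
        ≤ H * (m * s) + N * m * a + C * (N * s * (m * w)) := by gcongr
      _ = H * (m * s) * ((N : ℝ≥0∞)⁻¹ * N) + N * m * a * ((s : ℝ≥0∞)⁻¹ * s) +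
          C * (N * s * (m * w)) := by rw [hN1, hs1, mul_one, mul_one]
      _ = _ := by ring
  have h2 : ∀ m : ℕ, 1 ≤ m → entropyRate μ (santaFe K Z) ≤
      a / s + C * ⨆ k : ℕ, expectedCard μ (typeSet K (k + 1) (k + m)) / m := by
    intro m hm
    have hlim := (ENNReal.Tendsto.const_mul ENNReal.tendsto_inv_nat_nhds_zero
      (Or.inr hH)).add_const
        (a / s + C * ⨆ k : ℕ, expectedCard μ (typeSet K (k + 1) (k + m)) / m)
    rw [mul_zero, zero_add] at hlim
    exact ge_of_tendsto hlim (Filter.eventually_atTop.2 ⟨1, fun N hN => h1 m N hm hN⟩)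
  -- With `C` moved to the left, the bounds for all m pass to their infimum v.
  have h3 : (entropyRate μ (santaFe K Z) - a / s) / C ≤ typeRate μ K :=
    le_iInf₂ fun m hm => ENNReal.div_le_of_le_mul' (tsub_le_iff_left.2 (h2 m hm))
  rw [hv, nonpos_iff_eq_zero, ENNReal.div_eq_zero_iff] at h3
  exact tsub_eq_zero_iff_le.1 (h3.resolve_right hC)

theorem add_le_condShannonEntropy_santaFe (hK : ∀ t, Measurable (K t))
    (hZ : ∀ k, Measurable (Z k)) (hZindep : iIndepFun Z μ)
    (hZK : IndepFun (fun ω (k : ℕ) => Z k ω) (fun ω (t : ℤ) => K t ω) μ)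
    {C : ℝ≥0∞} (hZlow : ∀ k, C ≤ shannonEntropy μ (Z k)) (k s t : ℕ)
    (hfin : jointEntropy μ (santaFe K Z) (window 0 t) ≠ ∞) :
    (jointEntropy μ K (window k s ∪ window 0 t) - jointEntropy μ K (window 0 t)) / s +
        C * newTypeRate μ K k s t ≤
      condShannonEntropy μ (block (santaFe K Z) (k + 1) (k + s)) (block (santaFe K Z) 1 t) / s := by
  have hfinK : jointEntropy μ K (window 0 t) ≠ ∞ := by
    rw [jointEntropy_santaFe hK hZ hZindep hZK] at hfin
    exact (ENNReal.add_ne_top.1 hfin).1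
  have hc : condShannonEntropy μ (block (santaFe K Z) (k + 1) (k + s))
      (block (santaFe K Z) 1 t) = jointEntropy μ (santaFe K Z) (window k s ∪ window 0 t) -
        jointEntropy μ (santaFe K Z) (window 0 t) := by
    rw [← shannonEntropy_joint_pair, window_zero_left]
    rfl
  have hn : newTypeRate μ K k s t = expectedCard μ
      (fun ω => valueSet K (window k s) ω \ valueSet K (window 0 t) ω) / s := by
    rw [window_zero_left]
    rfl
  rw [hc, hn, ← mul_div_assoc, ENNReal.div_add_div_same]
  refine ENNReal.div_le_div_right (ENNReal.le_sub_of_add_le_right hfin ?_) _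
  have h := jointEntropy_santaFe_union_ge hK hZ hZindep hZK hZlow (window k s) (window 0 t)
  have hm : jointEntropy μ K (window 0 t) ≤ jointEntropy μ K (window k s ∪ window 0 t) :=
    jointEntropy_mono Set.subset_union_right
  refine (ENNReal.add_le_add_iff_right hfinK).1 (le_trans (le_of_eq ?_) h)
  -- The joint narration entropy becomes increment plus H(K_1^t); the latter is finite and was added
  -- to both sides for cancellation.
  nth_rewrite 2 [← tsub_add_cancel_of_le hm]
  ring

theorem jointEntropy_santaFe_ne_top (hK : ∀ t, Measurable (K t)) (hZ : ∀ k, Measurable (Z k))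
    (hZindep : iIndepFun Z μ)
    (hZK : IndepFun (fun ω (k : ℕ) => Z k ω) (fun ω (t : ℤ) => K t ω) μ)
    {C : ℝ≥0∞} (hC : C ≠ ∞) (hZup : ∀ k, shannonEntropy μ (Z k) ≤ C) (k m : ℕ)
    (h : ∀ i ∈ window k m, shannonEntropy μ (K i) < ∞) :
    jointEntropy μ (santaFe K Z) (window k m) ≠ ∞ := by
  refine ne_top_of_le_ne_top ?_ (jointEntropy_santaFe_le hK hZ hZindep hZK hZup (window k m))
  refine ENNReal.add_ne_top.2 ⟨(jointEntropy_lt_top hK h).ne, ENNReal.mul_ne_top hC ?_⟩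
  refine ((expectedCard_valueSet_le _).trans_lt ?_).ne
  rw [window_encard]
  exact ENNReal.natCast_lt_top m

/-- Finite h gives some s ≥ 1 for which all windows starting at a positive time have finite entropy,
and the time `i` is the first of such a window. -/
theorem shannonEntropy_narration_lt_top (hK : ∀ t, Measurable (K t)) (hZ : ∀ k, Measurable (Z k))
    (hZindep : iIndepFun Z μ)
    (hZK : IndepFun (fun ω (k : ℕ) => Z k ω) (fun ω (t : ℤ) => K t ω) μ)
    (h : entropyRate μ (santaFe K Z) < ∞) (i : ℤ) (hi : 1 ≤ i) : shannonEntropy μ (K i) < ∞ := by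
  obtain ⟨s, hs⟩ := iInf_lt_iff.1 h
  obtain ⟨hs1, hs⟩ := iInf_lt_iff.1 hs
  obtain ⟨k, rfl⟩ : ∃ k : ℕ, i = k + 1 := ⟨(i - 1).toNat, by omega⟩
  have h1 : jointEntropy μ (santaFe K Z) (window k s) / s < ∞ :=
    (le_iSup (fun k : ℕ => shannonEntropy μ (block (santaFe K Z) (k + 1) (k + s)) / s)
      k).trans_lt hs
  have h2 : jointEntropy μ (santaFe K Z) (window k s) < ∞ := by
    by_contra hcon
    rw [not_lt_top_iff.1 hcon, ENNReal.top_div_of_ne_top (ENNReal.natCast_ne_top s)] at h1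
    exact lt_irrefl _ h1
  rw [jointEntropy_santaFe hK hZ hZindep hZK] at h2
  rw [← jointEntropy_singleton]
  refine (jointEntropy_mono fun j hj => ?_).trans_lt (ENNReal.add_lt_top.1 h2).1
  rw [Set.mem_singleton_iff] at hj
  simp only [window, Set.mem_Icc]
  omega

theorem entropyRate_santaFe_lt_top_of_stationary (hK : ∀ t, Measurable (K t))
    (hZ : ∀ k, Measurable (Z k)) (hZindep : iIndepFun Z μ)
    (hZK : IndepFun (fun ω (k : ℕ) => Z k ω) (fun ω (t : ℤ) => K t ω) μ)
    {C : ℝ≥0∞} (hC : C ≠ ∞) (hZup : ∀ k, shannonEntropy μ (Z k) ≤ C)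
    (hst : IsStationaryProcess μ K) (h : ∀ t, shannonEntropy μ (K t) < ∞) :
    entropyRate μ (santaFe K Z) < ∞ := by
  have hfin : jointEntropy μ K (window 0 1) + C * 1 < ∞ :=
    ENNReal.add_lt_top.2 ⟨jointEntropy_lt_top hK fun i _ => h i,
      ENNReal.mul_lt_top hC.lt_top ENNReal.one_lt_top⟩
  refine lt_of_le_of_lt (iInf₂_le_of_le 1 le_rfl (iSup_le fun k => ?_)) hfin
  have h1 := jointEntropy_santaFe_le hK hZ hZindep hZK hZup (window k 1)
  have h2 := expectedCard_valueSet_le (μ := μ) (K := K) (window k 1)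
  rw [window_encard, Nat.cast_one, ENat.toENNReal_one] at h2
  rw [jointEntropy_window_shift hK hst] at h1
  rw [Nat.cast_one (R := ℝ≥0∞), div_one]
  exact h1.trans (add_le_add_right (mul_le_mul_right h2 C) _)

end SantaFe

/-! ### Assembly of both statements -/

theorem EReal.mul_coe_ennreal_le_sub {C : ℝ} (hC : 0 ≤ C) {h S I : ℝ≥0∞} (hh : h ≠ ∞)
    (hle : h + ENNReal.ofReal C * I ≤ S) : (C : EReal) * (I : EReal) ≤ (S : EReal) - (h : EReal) := by
  have hCe : (C : EReal) = (ENNReal.ofReal C : EReal) := by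
    rw [EReal.coe_ennreal_ofReal, max_eq_left hC]
  rw [hCe, ← EReal.coe_ennreal_mul, EReal.le_sub_iff_add_le (Or.inl (by simp))
    (Or.inl (by simpa using hh)), ← EReal.coe_ennreal_add, EReal.coe_ennreal_le_coe_ennreal_iff,
    add_comm]
  exact hle

theorem mainTheorem2 {Ω α : Type*} [MeasurableSpace Ω] [MeasurableSpace α] [Countable α]
    [MeasurableSingletonClass α] (μ : Measure Ω) [IsProbabilityMeasure μ]
    (K : ℤ → Ω → ℕ) (hK : ∀ t, Measurable (K t))
    (Z : ℕ → Ω → α) (hZ : ∀ k, Measurable (Z k))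
    (hZindep : iIndepFun Z μ)
    (hZK : IndepFun (fun ω (k : ℕ) => Z k ω) (fun ω (t : ℤ) => K t ω) μ)
    (C₇ C₈ : ℝ) (hC₇ : 0 < C₇)
    (hZlow : ∀ k, ENNReal.ofReal C₇ ≤ shannonEntropy μ (Z k))
    (hZup : ∀ k, shannonEntropy μ (Z k) ≤ ENNReal.ofReal C₈) :
    (typeRate μ K = 0 → entropyRate μ (santaFe K Z) < ∞ → ∀ s t : ℕ, 1 ≤ s →
      (supCondEntropyRate μ (santaFe K Z) s t : EReal) - (entropyRate μ (santaFe K Z) : EReal) ≥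
        (C₇ : EReal) * ((⨅ (k : ℕ) (_ : t ≤ k), newTypeRate μ K k s t : ℝ≥0∞) : EReal)) ∧
    (IsStationaryProcess μ K → (∀ t, shannonEntropy μ (K t) < ∞) → ∀ s t : ℕ, 1 ≤ s →
      (supCondEntropyRate μ (santaFe K Z) s t : EReal) - (entropyRate μ (santaFe K Z) : EReal) ≥
        (C₇ : EReal) * ((⨆ (k : ℕ) (_ : t ≤ k), newTypeRate μ K k s t : ℝ≥0∞) : EReal) ∧
      (C₇ : EReal) * ((⨆ (k : ℕ) (_ : t ≤ k), newTypeRate μ K k s t : ℝ≥0∞) : EReal) ≥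
        (C₇ : EReal) * deltaTypes μ K (t + s)) := by
  have hC : ENNReal.ofReal C₈ ≠ ∞ := ENNReal.ofReal_ne_top
  set δ : ℕ → ℕ → ℕ → ℝ≥0∞ := fun k s t =>
    jointEntropy μ K (window k s ∪ window 0 t) - jointEntropy μ K (window 0 t)
  have hδ : ∀ k s t, jointEntropy μ K (window k s ∪ window 0 t) ≤
      δ k s t + jointEntropy μ K (window 0 t) := fun k s t => le_tsub_add
  have hcond := fun k s t =>
    add_le_condShannonEntropy_santaFe hK hZ hZindep hZK hZlow k s t
  have hle : ∀ k s t : ℕ, t ≤ k → condShannonEntropy μ (block (santaFe K Z) (k + 1) (k + s))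
      (block (santaFe K Z) 1 t) / s ≤ supCondEntropyRate μ (santaFe K Z) s t := fun k s t hk =>
    le_iSup₂_of_le k hk le_rfl
  refine ⟨fun hv hh s t hs => ?_, fun hst hKfin s t hs => ⟨?_, ?_⟩⟩
  · have hKfin : ∀ i ∈ window 0 t, shannonEntropy μ (K i) < ∞ := fun i hi =>
      shannonEntropy_narration_lt_top hK hZ hZindep hZK hh i (by
        rw [window_zero_left] at hi; exact hi.1)
    -- The range k ≥ t is indexed by k = t + j, since addition commutes with a supremum over a
    -- nonempty type.
    have hrate : entropyRate μ (santaFe K Z) ≤ (⨆ j : ℕ, δ (t + j) s t) / s :=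
      entropyRate_santaFe_le hK hZ hZindep hZK hC hZup hv hs (jointEntropy_lt_top hK hKfin).ne
        (jointEntropy_window_le_of_cond hK s t (jointEntropy_lt_top hK hKfin).ne fun k hk => by
          obtain ⟨j, rfl⟩ := Nat.exists_eq_add_of_le hk
          exact (hδ _ s t).trans
            (add_le_add_left (le_iSup (fun j : ℕ => δ (t + j) s t) j) _))
    refine EReal.mul_coe_ennreal_le_sub hC₇.le hh.ne ((add_le_add_left hrate _).trans ?_)
    rw [ENNReal.iSup_div, ENNReal.iSup_add]
    refine iSup_le fun j => ?_
    refine le_trans ?_ ((hcond (t + j) s t (jointEntropy_santaFe_ne_top hK hZ hZindep hZK hC hZup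
      0 t hKfin)).trans (hle _ s t (Nat.le_add_right t j)))
    exact add_le_add_right (mul_le_mul_right (iInf₂_le (t + j) (Nat.le_add_right t j)) _) _
  · have hh := entropyRate_santaFe_lt_top_of_stationary hK hZ hZindep hZK hC hZup hst hKfin
    refine EReal.mul_coe_ennreal_le_sub hC₇.le hh.ne ?_
    have hX := jointEntropy_santaFe_ne_top hK hZ hZindep hZK hC hZup 0 t fun i _ => hKfin i
    have hk : ∀ k, t ≤ k → entropyRate μ (santaFe K Z) + ENNReal.ofReal C₇ * newTypeRate μ K k s t ≤
        supCondEntropyRate μ (santaFe K Z) s t := by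
      intro k hk
      have hfin : ∀ m, jointEntropy μ K (window 0 m) ≠ ∞ := fun m =>
        (jointEntropy_lt_top hK fun i _ => hKfin i).ne
      have hrate : entropyRate μ (santaFe K Z) ≤ δ k s t / s := by
        refine entropyRate_santaFe_le hK hZ hZindep hZK hC hZup
          (typeRate_eq_zero_of_stationary hK hst) hs (hfin k)
          (jointEntropy_window_le_of_stationary hK hst s k (hfin k) ?_)
        -- As t ≤ k, conditioning on K_1^k instead of K_1^t does not increase the entropy of the
        -- block after k, so `δ k s t` bounds the increment at k.
        have h := jointEntropy_submodular (μ := μ) hK (window k s) (window 0 k) (window 0 t)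
        have h1 : window k s ∪ window 0 k ∪ window 0 t = window 0 (k + s) := by
          ext i
          simp only [window, Set.mem_Icc, Set.mem_union]
          omega
        have h2 : window 0 k ∪ window 0 t = window 0 k := by
          ext i
          simp only [window, Set.mem_Icc, Set.mem_union]
          omega
        rw [h1, h2] at h
        refine (ENNReal.add_le_add_iff_right (hfin t)).1 (h.trans ?_)
        exact (add_le_add_left (hδ k s t) _).trans_eq (by ring)
      exact (add_le_add_left hrate _).trans ((hcond k s t hX).trans (hle k s t hk))
    have hsup : (⨆ (k : ℕ) (_ : t ≤ k), newTypeRate μ K k s t) =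
        ⨆ j : ℕ, newTypeRate μ K (t + j) s t := by
      refine le_antisymm (iSup₂_le fun k hk => ?_) (iSup_le fun j => ?_)
      · obtain ⟨j, rfl⟩ := Nat.exists_eq_add_of_le hk
        exact le_iSup (fun j => newTypeRate μ K (t + j) s t) j
      · exact le_iSup₂_of_le (t + j) (Nat.le_add_right t j) le_rfl
    rw [hsup, ENNReal.mul_iSup, ENNReal.add_iSup]
    exact iSup_le fun j => hk (t + j) (Nat.le_add_right t j)
  · refine mul_le_mul_of_nonneg_left ?_ (by exact_mod_cast hC₇.le)
    -- The term k = t of the supremum suffices.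
    refine (deltaTypes_le_newTypeRate hK hst s t hs).trans ?_
    exact EReal.coe_ennreal_le_coe_ennreal_iff.2
      (le_iSup₂_of_le (f := fun (k : ℕ) (_ : t ≤ k) => newTypeRate μ K k s t) t le_rfl le_rfl)
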